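/- Let $d_1,d_2$ be natural numbers, let $M_{d_1\times d_2}$ be the space of complex $d_1\times d_2$ matrices and $M_d=M_{d\times d}$. For $V\in M_{d_1\times d_2}$ let $\mathrm{Ad}_V(X)=V^*XV$, $X\in M_{d_1}$. A linear map $\Phi:M_{d_1}\to M_{d_2}$ is completely positive (CP) if for every $k\ge 1$ the map $\mathrm{id}_k\otimes\Phi:M_k\otimes M_{d_1}\to M_k\otimes M_{d_2}$ sends positive semidefinite matrices to positive semidefinite matrices. A CP map $\Phi$ is entanglement breaking (EB) if moreover, for every $k\ge1$ and every positive semidefinite $X\in M_k\otimes M_{d_1}$, the matrix $(\mathrm{id}_k\otimes\Phi)(X)$ is separable, i.e. a finite sum $\sum_i A_i\otimes B_i$ with positive semidefinite $A_i\in M_k$, $B_i\in M_{d_2}$. Let $\mathrm{UEB}(d_1,d_2)$ be the set of EB maps $\Phi:M_{d_1}\to M_{d_2}$ with $\Phi(I)=I$. Two linear maps $\Phi,\Psi:M_{d_1}\to M_{d_2}$ are unitarily equivalent, $\Psi\cong\Phi$, if $\Psi=\mathrm{Ad}_U\circ\Phi$ for some unitary $U\in M_{d_2}$. A map $\Phi\in\mathrm{UEB}(d_1,d_2)$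 is a $C^*$-extreme point of $\mathrm{UEB}(d_1,d_2)$ if, whenever $\Phi=\sum_{i=1}^n\mathrm{Ad}_{T_i}\circ\Phi_i$ with $\Phi_i\in\mathrm{UEB}(d_1,d_2)$ and invertible $T_i\in M_{d_2}$ satisfying $\sum_{i=1}^nT_i^*T_i=I$, one has $\Phi_i\cong\Phi$ for all $i$. The Choi-rank of a CP map $\Phi$ is the minimum number $n$ of linearly independent matrices $V_i\in M_{d_1\times d_2}$ with $\Phi=\sum_{i=1}^n\mathrm{Ad}_{V_i}$; the EB-rank of $\Phi\in\mathrm{UEB}(d_1,d_2)$ is the minimum number $n$ of rank-one matrices $V_i\in M_{d_1\times d_2}$ with $\Phi=\sum_{i=1}^n\mathrm{Ad}_{V_i}$. A CP map $\Phi$ is pure if every CP map $\Psi$ such that $\Phi-\Psi$ is CP is of the form $\Psi=\lambda\Phi$ with $\lambda\ge0$; a pure state on $M_d$ is a unital pure CP map $M_d\to\mathbb C=M_1$. Inner products are linear in the second variable, and $|x\rangle\langle y|$ denotes the matrix of $z\mapsto\langle y,z\rangle x$. **Theorem.** For $\Phi\in\mathrm{UEB}(d_1,d_2)$ the following conditions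 are equivalent: 1. $\Phi$ is a $C^*$-extreme point of $\mathrm{UEB}(d_1,d_2)$. 2. There are rank-one matrices $V_1,\dots,V_{d_2}\in M_{d_1\times d_2}$ with $\Phi=\sum_{i=1}^{d_2}\mathrm{Ad}_{V_i}$ such that, for every subset $S\subseteq\{1,\dots,d_2\}$ with fewer than $d_2$ elements, the matrix $\sum_{i\in S}V_i^*V_i$ is not invertible. 3. The EB-rank of $\Phi$ equals $d_2$. 4. The Choi-rank of $\Phi$ equals $d_2$. 5. There are $n\le d_2$, distinct pure states $\phi_1,\dots,\phi_n:M_{d_1}\to\mathbb C$ and mutually orthogonal projections $P_1,\dots,P_n\in M_{d_2}$ with $\sum_{i=1}^nP_i=I$ such that $\Phi(X)=\sum_{i=1}^n\phi_i(X)P_i$ for all $X\in M_{d_1}$. 6. There are unit vectors $u_1,\dots,u_{d_2}\in\mathbb C^{d_1}$ and an orthonormal basis $v_1,\dots,v_{d_2}$ of $\mathbb C^{d_2}$ such that $\Phi(X)=\sum_{i=1}^{d_2}\langle u_i,Xu_i\rangle\,|v_i\rangle\langle v_i|$ for all $X\in M_{d_1}$. 7. There are pure states $\phi_1,\dots,\phi_{d_2}:M_{d_1}\to\mathbb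 C$ such that $\Phi\cong\bigoplus_{i=1}^{d_2}\phi_i$, where $\bigl(\bigoplus_i\phi_i\bigr)(X)=\mathrm{diag}(\phi_1(X),\dots,\phi_{d_2}(X))$. -/

import Mathlib

open scoped Matrix Kronecker ComplexOrder

noncomputable section

namespace EBMaps

/-- The algebra of complex `d × d` matrices. -/
abbrev Mat (d : ℕ) : Type := Matrix (Fin d) (Fin d) ℂ

/-- Matrices of `M_k ⊗ M_d = M_k(M_d)`, indexed by pairs (block index, inner index). -/
abbrev BiMat (k d : ℕ) : Type := Matrix (Fin k × Fin d) (Fin k × Fin d) ℂ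

/-- `id_k ⊗ Φ : M_k ⊗ M_{d₁} → M_k ⊗ M_{d₂}`: apply `Φ` to each block. -/
def ampliation (k : ℕ) {d₁ d₂ : ℕ} (Φ : Mat d₁ →ₗ[ℂ] Mat d₂) (X : BiMat k d₁) : BiMat k d₂ :=
  Matrix.of fun p q => Φ (Matrix.of fun a b => X (p.1, a) (q.1, b)) p.2 q.2

/-- On elementary tensors, `(id_k ⊗ Φ)(A ⊗ B) = A ⊗ Φ(B)`. -/
theorem ampliation_kronecker (k : ℕ) {d₁ d₂ : ℕ} (Φ : Mat d₁ →ₗ[ℂ] Mat d₂)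
    (A : Mat k) (B : Mat d₁) : ampliation k Φ (A ⊗ₖ B) = A ⊗ₖ Φ B := by
  ext p q
  have h : (Matrix.of fun a b => (A ⊗ₖ B) (p.1, a) (q.1, b)) = A p.1 q.1 • B := by
    ext a b
    simp [Matrix.kroneckerMap_apply]
  rw [ampliation, Matrix.of_apply, h, map_smul, Matrix.smul_apply, smul_eq_mul,
    Matrix.kroneckerMap_apply]

/-- Completely positive maps. -/
def IsCP {d₁ d₂ : ℕ} (Φ : Mat d₁ →ₗ[ℂ] Mat d₂) : Prop :=
  ∀ k : ℕ, 1 ≤ k → ∀ X : BiMat k d₁, X.PosSemidef → (ampliation k Φ X).PosSemidef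

/-- Separable elements of `M_k ⊗ M_d`. -/
def IsSeparable {k d : ℕ} (X : BiMat k d) : Prop :=
  ∃ (n : ℕ) (A : Fin n → Mat k) (B : Fin n → Mat d),
    (∀ i, (A i).PosSemidef) ∧ (∀ i, (B i).PosSemidef) ∧ X = ∑ i, A i ⊗ₖ B i

/-- Entanglement breaking maps. -/
def IsEB {d₁ d₂ : ℕ} (Φ : Mat d₁ →ₗ[ℂ] Mat d₂) : Prop :=
  IsCP Φ ∧ ∀ k : ℕ, 1 ≤ k → ∀ X : BiMat k d₁, X.PosSemidef → IsSeparable (ampliation k Φ X)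

/-- The set of unital entanglement breaking maps `M_{d₁} → M_{d₂}`. -/
def UEB (d₁ d₂ : ℕ) : Set (Mat d₁ →ₗ[ℂ] Mat d₂) :=
  {Φ | IsEB Φ ∧ Φ 1 = 1}

/-- `Ad_V (X) = V^* X V`. -/
def Ad {d₁ d₂ : ℕ} (V : Matrix (Fin d₁) (Fin d₂) ℂ) : Mat d₁ →ₗ[ℂ] Mat d₂ where
  toFun X := Vᴴ * X * V
  map_add' X Y := by rw [Matrix.mul_add, Matrix.add_mul]
  map_smul' c X := by simp

/-- Unitary equivalence `Ψ ≅ Φ`. -/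
def UnitarilyEquivalent {d₁ d₂ : ℕ} (Ψ Φ : Mat d₁ →ₗ[ℂ] Mat d₂) : Prop :=
  ∃ U ∈ Matrix.unitaryGroup (Fin d₂) ℂ, Ψ = Ad U ∘ₗ Φ

/-- `Φ` is a C*-extreme point of `UEB d₁ d₂`. -/
def IsCStarExtreme {d₁ d₂ : ℕ} (Φ : Mat d₁ →ₗ[ℂ] Mat d₂) : Prop :=
  Φ ∈ UEB d₁ d₂ ∧
    ∀ (n : ℕ) (T : Fin n → Mat d₂) (Ψ : Fin n → (Mat d₁ →ₗ[ℂ] Mat d₂)),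
      (∀ i, IsUnit (T i)) → (∑ i, (T i)ᴴ * T i = 1) → (∀ i, Ψ i ∈ UEB d₁ d₂) →
      Φ = ∑ i, Ad (T i) ∘ₗ Ψ i → ∀ i, UnitarilyEquivalent (Ψ i) Φ

/-- The Choi-rank: the minimum number of linearly independent Kraus operators in a Kraus
decomposition of the completely positive map `Φ`. -/
def choiRank {d₁ d₂ : ℕ} (Φ : Mat d₁ →ₗ[ℂ] Mat d₂) : ℕ :=
  sInf {n | ∃ V : Fin n → Matrix (Fin d₁) (Fin d₂) ℂ,
    LinearIndependent ℂ V ∧ Φ = ∑ i, Ad (V i)}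

/-- The entanglement breaking rank: the minimum number of rank-one Kraus operators in a
decomposition of the entanglement breaking map `Φ`. -/
def ebRank {d₁ d₂ : ℕ} (Φ : Mat d₁ →ₗ[ℂ] Mat d₂) : ℕ :=
  sInf {n | ∃ V : Fin n → Matrix (Fin d₁) (Fin d₂) ℂ,
    (∀ i, (V i).rank = 1) ∧ Φ = ∑ i, Ad (V i)}

/-- Pure completely positive maps. -/
def IsPure {d₁ d₂ : ℕ} (Φ : Mat d₁ →ₗ[ℂ] Mat d₂) : Prop :=
  IsCP Φ ∧ ∀ Ψ : Mat d₁ →ₗ[ℂ] Mat d₂, IsCP Ψ → IsCP (Φ - Ψ) → ∃ c : ℝ, 0 ≤ c ∧ Ψ = (c : ℂ) • Φ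

/-- The direct sum `⊕ φ_i` of functionals on `M_d`, i.e. `X ↦ diag(φ_1(X), …, φ_m(X))`. -/
def directSum {d m : ℕ} (φ : Fin m → (Mat d →ₗ[ℂ] ℂ)) : Mat d →ₗ[ℂ] Mat m where
  toFun X := Matrix.diagonal fun i => φ i X
  map_add' X Y := by simp [Matrix.diagonal_add]
  map_smul' c X := by simp [← Matrix.diagonal_smul, Pi.smul_def]

/-- Pure states: unital functionals that, regarded as maps `M_d → M_1`, are (completely positive
and) pure. -/
def IsPureState {d : ℕ} (φ : Mat d →ₗ[ℂ] ℂ) : Prop :=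
  φ 1 = 1 ∧ IsPure (directSum fun _ : Fin 1 => φ)

/-- `|x⟩⟨y|`, the matrix of `z ↦ ⟨y, z⟩ x`. -/
def ketBra {d₁ d₂ : ℕ} (x : EuclideanSpace ℂ (Fin d₁)) (y : EuclideanSpace ℂ (Fin d₂)) :
    Matrix (Fin d₁) (Fin d₂) ℂ :=
  Matrix.of fun i j => x i * star (y j)

end EBMaps

end

open EBMaps

/-!
All seven conditions are compared with one normal form, `IsVecStateSum`: up to unitary equivalence
`Φ` is a direct sum of `d₂` vector states `X ↦ ⟨u, X u⟩` with unit vectors `u`. Condition 6 is this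
form written in an orthonormal basis, and condition 7 is the same because the pure states are
exactly the vector states (`isPureState_iff`).

Expanding a separable decomposition of the Choi matrix gives every unital entanglement breaking map
the form `Φ = ∑ ⟨x_k, · x_k⟩ |y_k⟩⟨y_k|` with unit vectors `x_k` and `∑ |y_k⟩⟨y_k| = 1`
(`IsEB.exists_kraus`). The `y_k` span `ℂ^d₂`, so some `d₂` of them form a basis. If there are only
`d₂` terms, then the `y_k` are orthonormal and `Φ` has the normal form; this settles conditions
2 and 3.

For a `C*`-extreme `Φ`, half of the terms belonging to a basis can be split off. This part is
`Ad T₁` of a direct sum of vector states with `T₁` invertible, the rest is `Ad T₂` of a unital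
entanglement breaking map with `T₂` invertible, and extremality makes the direct sum unitarily
equivalent to `Φ` (`IsCStarExtreme.isVecStateSum`).

The remaining implications towards the normal form, and the one from it to extremality, produce an
invertible matrix that intertwines two `*`-preserving maps; its polar decomposition makes them
unitarily equivalent (`unitarilyEquivalent_of_intertwining`). To find the intertwiner one uses that
the Kraus operators of one decomposition lie in the span of those of any other one
(`mem_span_of_sum_Ad_eq`): a Kraus operator `|x⟩⟨y|` in the span of operators `|u_l⟩⟨e_l|` forces
`x` to be proportional to `u_l` whenever the `l`-th coordinate of `y` is nonzero, so `x` and `u_l`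
define the same state (`directSum_vecState_intertwining`).
-/

open EBMaps

open Matrix

namespace EBMaps

/-! ### Kraus decompositions -/

theorem Ad_apply {d₁ d₂ : ℕ} (V : Matrix (Fin d₁) (Fin d₂) ℂ) (X : Mat d₁) :
    Ad V X = Vᴴ * X * V := rfl

theorem Ad_comp_Ad {d₁ d₂ d₃ : ℕ} (T : Matrix (Fin d₂) (Fin d₃) ℂ)
    (V : Matrix (Fin d₁) (Fin d₂) ℂ) : Ad T ∘ₗ Ad V = Ad (V * T) := by
  ext1 X
  simp [Ad_apply, Matrix.mul_assoc]

theorem Ad_comp_sum {ι : Type*} {d₁ d₂ d₃ : ℕ} (T : Matrix (Fin d₂) (Fin d₃) ℂ) (s : Finset ι)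
    (Φ : ι → (Mat d₁ →ₗ[ℂ] Mat d₂)) : Ad T ∘ₗ ∑ i ∈ s, Φ i = ∑ i ∈ s, Ad T ∘ₗ Φ i := by
  ext1 X
  simp

theorem Ad_smul {d₁ d₂ : ℕ} (c : ℂ) (V : Matrix (Fin d₁) (Fin d₂) ℂ) :
    Ad (c • V) = (star c * c) • Ad V := by
  ext1 X
  simp [Ad_apply, smul_smul, mul_comm]

theorem Ad_conjTranspose {d₁ d₂ : ℕ} (V : Matrix (Fin d₁) (Fin d₂) ℂ) (X : Mat d₁) :
    Ad V Xᴴ = (Ad V X)ᴴ := by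
  simp [Ad_apply, Matrix.mul_assoc]

theorem Ad_single_apply {d₁ d₂ : ℕ} (V : Matrix (Fin d₁) (Fin d₂) ℂ) (a b : Fin d₁)
    (c d : Fin d₂) : Ad V (single a b 1) c d = star (V a c) * V b d := by
  simp [Ad_apply, Matrix.mul_apply, single_apply, ite_and]

theorem linearMap_ext_single {d₁ d₂ : ℕ} {Φ Ψ : Mat d₁ →ₗ[ℂ] Mat d₂}
    (h : ∀ a b c d, Φ (single a b 1) c d = Ψ (single a b 1) c d) : Φ = Ψ :=
  Matrix.ext_linearMap _ fun a b => LinearMap.ext_ring <| by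
    ext c d
    simpa using h a b c d

/-- The functional `X ↦ ⟨u, X u⟩`; it is a state when `u` is a unit vector. -/
def vecState {d : ℕ} (u : Fin d → ℂ) : Mat d →ₗ[ℂ] ℂ where
  toFun X := star u ⬝ᵥ X *ᵥ u
  map_add' X Y := by rw [add_mulVec, dotProduct_add]
  map_smul' c X := by rw [smul_mulVec, dotProduct_smul, RingHom.id_apply]

theorem vecState_apply {d : ℕ} (u : Fin d → ℂ) (X : Mat d) :
    vecState u X = star u ⬝ᵥ X *ᵥ u := rfl

theorem vecState_one {d : ℕ} (u : Fin d → ℂ) : vecState u 1 = star u ⬝ᵥ u := by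
  rw [vecState_apply, one_mulVec]

theorem vecState_smul {d : ℕ} (c : ℂ) (u : Fin d → ℂ) :
    vecState (c • u) = (star c * c) • vecState u := by
  ext1 X
  simp only [vecState_apply, mulVec_smul, star_smul, smul_dotProduct, dotProduct_smul,
    LinearMap.smul_apply, smul_smul, mul_comm]

theorem Ad_vecMulVec {d₁ d₂ : ℕ} (x : Fin d₁ → ℂ) (y : Fin d₂ → ℂ) (X : Mat d₁) :
    Ad (vecMulVec x (star y)) X = vecState x X • vecMulVec y (star y) := by
  rw [Ad_apply, conjTranspose_vecMulVec, star_star, Matrix.mul_assoc, mul_vecMulVec,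
    vecMulVec_mul_vecMulVec, vecMulVec_smul, vecState_apply]

theorem exists_unit_vecMulVec {d₁ d₂ : ℕ} (h : 0 < d₁) (x : Fin d₁ → ℂ) (y : Fin d₂ → ℂ) :
    ∃ (x' : Fin d₁ → ℂ) (y' : Fin d₂ → ℂ), star x' ⬝ᵥ x' = 1 ∧
      vecMulVec x (star y) = vecMulVec x' (star y') := by
  by_cases hx : x = 0
  · refine ⟨Pi.single ⟨0, h⟩ 1, 0, by simp, ?_⟩
    ext i j
    simp [hx, vecMulVec_apply]
  · have h0 : 0 < star x ⬝ᵥ x := dotProduct_star_self_pos_iff.2 hx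
    obtain ⟨r, hr, hr'⟩ : ∃ r : ℝ, 0 < r ∧ star x ⬝ᵥ x = (r : ℂ) := by
      refine ⟨(star x ⬝ᵥ x).re, (Complex.pos_iff.1 h0).1, ?_⟩
      exact Complex.ext rfl (by simpa using (Complex.pos_iff.1 h0).2.symm)
    have hs : ((Real.sqrt r : ℝ) : ℂ) ≠ 0 := by
      exact_mod_cast (Real.sqrt_pos.2 hr).ne'
    have hss : ((Real.sqrt r : ℝ) : ℂ) * (Real.sqrt r : ℝ) = r := by
      exact_mod_cast Real.mul_self_sqrt hr.le
    refine ⟨((Real.sqrt r : ℝ) : ℂ)⁻¹ • x, ((Real.sqrt r : ℝ) : ℂ) • y, ?_, ?_⟩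
    · rw [star_smul, smul_dotProduct, dotProduct_smul, hr', ← hss]
      simp only [star_inv₀, RCLike.star_def, Complex.conj_ofReal, smul_eq_mul]
      field_simp
    · rw [star_smul, smul_vecMulVec, vecMulVec_smul, smul_smul]
      simp [hs]

/-- The Choi matrix `∑ E_ab ⊗ Φ(E_ab)` is the image of a positive semidefinite matrix under
the ampliation of `Φ`. -/
theorem exists_posSemidef_ampliation_apply {d₁ d₂ : ℕ} (Φ : Mat d₁ →ₗ[ℂ] Mat d₂) :
    ∃ X : BiMat d₁ d₁, X.PosSemidef ∧
      ∀ a b c d, ampliation d₁ Φ X (a, c) (b, d) = Φ (single a b 1) c d := by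
  let w : Fin d₁ × Fin d₁ → ℂ := fun p => if p.1 = p.2 then 1 else 0
  refine ⟨vecMulVec w (star w), posSemidef_vecMulVec_self_star w, fun a b c d => ?_⟩
  have hX : (of fun i j => vecMulVec w (star w) (a, i) (b, j)) = single a b (1 : ℂ) := by
    ext i j
    simp only [of_apply, vecMulVec_apply, w, Pi.star_apply, single_apply]
    split_ifs <;> simp_all
  rw [ampliation, of_apply, hX]

/-- Choi's theorem: a completely positive map has a Kraus decomposition. -/
theorem IsCP.exists_kraus {d₁ d₂ : ℕ} {Φ : Mat d₁ →ₗ[ℂ] Mat d₂} (h : IsCP Φ) :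
    ∃ (m : ℕ) (V : Fin m → Matrix (Fin d₁) (Fin d₂) ℂ), Φ = ∑ t, Ad (V t) := by
  rcases Nat.eq_zero_or_pos d₁ with rfl | hd
  · exact ⟨0, Fin.elim0, linearMap_ext_single fun a => a.elim0⟩
  obtain ⟨X, hX, hC⟩ := exists_posSemidef_ampliation_apply Φ
  obtain ⟨m, v, hv⟩ := posSemidef_iff_eq_sum_vecMulVec.1 (h d₁ hd X hX)
  refine ⟨m, fun t => of fun a c => star (v t (a, c)), linearMap_ext_single fun a b c d => ?_⟩
  rw [← hC, hv]
  simp [Matrix.sum_apply, Ad_single_apply, vecMulVec_apply]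

/-- An entanglement breaking map has a Kraus decomposition into rank-one operators: expand
both factors of every term of a separable decomposition of the Choi matrix. -/
theorem IsEB.exists_kraus {d₁ d₂ : ℕ} {Φ : Mat d₁ →ₗ[ℂ] Mat d₂} (h : IsEB Φ) :
    ∃ (m : ℕ) (x : Fin m → Fin d₁ → ℂ) (y : Fin m → Fin d₂ → ℂ), (∀ t, star (x t) ⬝ᵥ x t = 1) ∧
      Φ = ∑ t, Ad (vecMulVec (x t) (star (y t))) := by
  rcases Nat.eq_zero_or_pos d₁ with rfl | hd
  · exact ⟨0, Fin.elim0, Fin.elim0, fun t => t.elim0, linearMap_ext_single fun a => a.elim0⟩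
  obtain ⟨X, hX, hC⟩ := exists_posSemidef_ampliation_apply Φ
  obtain ⟨n, A, B, hA, hB, hs⟩ := h.2 d₁ hd X hX
  choose p v hv using fun i => posSemidef_iff_eq_sum_vecMulVec.1 (hA i)
  choose q w hw using fun i => posSemidef_iff_eq_sum_vecMulVec.1 (hB i)
  choose x y hx hxy using fun t : (i : Fin n) × (Fin (p i) × Fin (q i)) =>
    exists_unit_vecMulVec hd (star (v t.1 t.2.1)) (w t.1 t.2.2)
  let e := Fintype.equivFin ((i : Fin n) × (Fin (p i) × Fin (q i)))
  refine ⟨_, fun t => x (e.symm t), fun t => y (e.symm t), fun t => hx _, ?_⟩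
  rw [e.symm.sum_comp fun t => Ad (vecMulVec (x t) (star (y t)))]
  refine linearMap_ext_single fun a b c d => ?_
  rw [← hC, hs]
  simp only [← hxy, LinearMap.sum_apply, Matrix.sum_apply, Ad_single_apply, kroneckerMap_apply,
    Fintype.sum_sigma]
  refine Finset.sum_congr rfl fun i _ => ?_
  rw [Fintype.sum_prod_type, hv i, hw i, Matrix.sum_apply, Matrix.sum_apply, Finset.sum_mul_sum]
  refine Finset.sum_congr rfl fun j _ => Finset.sum_congr rfl fun k _ => ?_
  simp only [vecMulVec_apply, Pi.star_apply, star_mul', star_star]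
  ring

/-- The Kraus operators of one decomposition lie in the span of those of any other one: for
every functional `ℓ` the number `∑ |ℓ(V i)|²` depends on `∑ Ad (V i)` only. -/
theorem mem_span_of_sum_Ad_eq {ι κ : Type*} [Fintype ι] [Fintype κ] {d₁ d₂ : ℕ}
    {V : ι → Matrix (Fin d₁) (Fin d₂) ℂ} {W : κ → Matrix (Fin d₁) (Fin d₂) ℂ}
    (h : ∑ i, Ad (V i) = ∑ j, Ad (W j)) (i : ι) : V i ∈ Submodule.span ℂ (Set.range W) := by
  by_contra hi
  obtain ⟨f, hf, hle⟩ := Submodule.exists_le_ker_of_notMem hi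
  have hexp : ∀ Z, f Z = ∑ p : Fin d₁ × Fin d₂, f (single p.1 p.2 1) * Z p.1 p.2 := by
    intro Z
    conv_lhs => rw [matrix_eq_sum_single Z]
    simp only [map_sum, Fintype.sum_prod_type]
    refine Finset.sum_congr rfl fun a _ => Finset.sum_congr rfl fun c _ => ?_
    rw [← mul_one (Z a c), ← smul_eq_mul, ← smul_single, map_smul, smul_eq_mul, smul_eq_mul,
      mul_one, mul_comm]
  have hsq : ∀ Z, star (f Z) * f Z = ∑ p : Fin d₁ × Fin d₂, ∑ q : Fin d₁ × Fin d₂,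
      star (f (single p.1 p.2 1)) * f (single q.1 q.2 1) *
        Ad Z (single p.1 q.1 1) p.2 q.2 := by
    intro Z
    rw [hexp Z, star_sum, Finset.sum_mul_sum]
    refine Finset.sum_congr rfl fun p _ => Finset.sum_congr rfl fun q _ => ?_
    rw [Ad_single_apply, star_mul']
    ring
  have hsum : ∑ i, star (f (V i)) * f (V i) = ∑ j, star (f (W j)) * f (W j) := by
    simp only [hsq]
    rw [Finset.sum_comm, Finset.sum_comm (γ := κ)]
    refine Finset.sum_congr rfl fun p _ => ?_
    rw [Finset.sum_comm, Finset.sum_comm (γ := κ)]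
    refine Finset.sum_congr rfl fun q _ => ?_
    rw [← Finset.mul_sum, ← Finset.mul_sum]
    congr 1
    simpa [Matrix.sum_apply] using congrArg (fun Θ => Θ (single p.1 q.1 1) p.2 q.2) h
  have hW : ∀ j, f (W j) = 0 := fun j => hle (Submodule.subset_span ⟨j, rfl⟩)
  simp only [hW, mul_zero, Finset.sum_const_zero] at hsum
  have h0 := (Finset.sum_eq_zero_iff_of_nonneg
    (fun i _ => star_mul_self_nonneg (f (V i)))).1 hsum i (Finset.mem_univ i)
  exact hf (by simpa using h0)

/-! ### Complete positivity and entanglement breaking of Kraus sums -/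

theorem ampliation_sum {ι : Type*} (k : ℕ) {d₁ d₂ : ℕ} (s : Finset ι)
    (Φ : ι → (Mat d₁ →ₗ[ℂ] Mat d₂)) (X : BiMat k d₁) :
    ampliation k (∑ i ∈ s, Φ i) X = ∑ i ∈ s, ampliation k (Φ i) X := by
  ext p q
  simp [ampliation, Matrix.sum_apply]

theorem ampliation_Ad (k : ℕ) {d₁ d₂ : ℕ} (V : Matrix (Fin d₁) (Fin d₂) ℂ) (X : BiMat k d₁) :
    ampliation k (Ad V) X = ((1 : Mat k) ⊗ₖ V)ᴴ * X * ((1 : Mat k) ⊗ₖ V) := by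
  ext p q
  simp [ampliation, Ad_apply, Matrix.mul_apply, Fintype.sum_prod_type, one_apply, apply_ite]

theorem isCP_sum_Ad {ι : Type*} {d₁ d₂ : ℕ} (s : Finset ι)
    (V : ι → Matrix (Fin d₁) (Fin d₂) ℂ) : IsCP (∑ i ∈ s, Ad (V i)) := by
  intro k _ X hX
  rw [ampliation_sum]
  refine posSemidef_sum _ fun i _ => ?_
  rw [ampliation_Ad]
  exact hX.conjTranspose_mul_mul_same _

theorem isCP_Ad {d₁ d₂ : ℕ} (V : Matrix (Fin d₁) (Fin d₂) ℂ) : IsCP (Ad V) := by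
  simpa using isCP_sum_Ad Finset.univ fun _ : Fin 1 => V

theorem exists_ampliation_Ad_vecMulVec (k : ℕ) {d₁ d₂ : ℕ} (x : Fin d₁ → ℂ) (y : Fin d₂ → ℂ)
    {X : BiMat k d₁} (hX : X.PosSemidef) : ∃ A : Mat k, A.PosSemidef ∧
      ampliation k (Ad (vecMulVec x (star y))) X = A ⊗ₖ vecMulVec y (star y) := by
  let M : Matrix (Fin k × Fin d₁) (Fin k) ℂ := of fun p q => if p.1 = q then x p.2 else 0
  refine ⟨Mᴴ * X * M, hX.conjTranspose_mul_mul_same M, ?_⟩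
  ext p q
  rw [ampliation, of_apply, Ad_vecMulVec, Matrix.smul_apply, kroneckerMap_apply, smul_eq_mul]
  congr 1
  simp only [vecState_apply, dotProduct, mulVec, Matrix.mul_apply, M, conjTranspose_apply,
    of_apply, Fintype.sum_prod_type, apply_ite star, star_zero, ite_mul, mul_ite, mul_zero,
    zero_mul, Finset.sum_ite_irrel, Finset.sum_const_zero, Finset.sum_ite_eq',
    Finset.mem_univ, if_true, Pi.star_apply, Finset.mul_sum, Finset.sum_mul]
  rw [Finset.sum_comm]
  simp only [mul_assoc]

theorem isEB_sum_Ad_vecMulVec {ι : Type*} [Fintype ι] {d₁ d₂ : ℕ} (x : ι → Fin d₁ → ℂ)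
    (y : ι → Fin d₂ → ℂ) : IsEB (∑ i, Ad (vecMulVec (x i) (star (y i)))) := by
  refine ⟨isCP_sum_Ad _ _, fun k _ X hX => ?_⟩
  choose A hA hAX using fun i => exists_ampliation_Ad_vecMulVec k (x i) (y i) hX
  let e := Fintype.equivFin ι
  refine ⟨_, fun t => A (e.symm t), fun t => vecMulVec (y (e.symm t)) (star (y (e.symm t))),
    fun t => hA _, fun t => posSemidef_vecMulVec_self_star _, ?_⟩
  rw [ampliation_sum, e.symm.sum_comp fun t => A t ⊗ₖ vecMulVec (y t) (star (y t))]
  exact Finset.sum_congr rfl fun i _ => hAX i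

/-! ### Intertwining -/

theorem UnitarilyEquivalent.symm {d₁ d₂ : ℕ} {Φ Ψ : Mat d₁ →ₗ[ℂ] Mat d₂}
    (h : UnitarilyEquivalent Ψ Φ) : UnitarilyEquivalent Φ Ψ := by
  obtain ⟨U, hU, rfl⟩ := h
  refine ⟨star U, Unitary.star_mem hU, ?_⟩
  rw [← LinearMap.comp_assoc, Ad_comp_Ad, (mem_unitaryGroup_iff).1 hU]
  ext1 X
  simp [Ad_apply]

theorem UnitarilyEquivalent.trans {d₁ d₂ : ℕ} {Φ Ψ Θ : Mat d₁ →ₗ[ℂ] Mat d₂}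
    (h : UnitarilyEquivalent Ψ Φ) (h' : UnitarilyEquivalent Φ Θ) : UnitarilyEquivalent Ψ Θ := by
  obtain ⟨U, hU, rfl⟩ := h
  obtain ⟨V, hV, rfl⟩ := h'
  exact ⟨V * U, mul_mem hV hU, by rw [← LinearMap.comp_assoc, Ad_comp_Ad]⟩

section
open scoped MatrixOrder

/-- Two `*`-preserving maps that are intertwined by an invertible matrix `S` are unitarily
equivalent, through the unitary factor `(S S*)^(-1/2) S` of the polar decomposition of `S`. -/
theorem unitarilyEquivalent_of_intertwining {d₁ d₂ : ℕ} {Ψ D : Mat d₁ →ₗ[ℂ] Mat d₂}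
    (hΨ : ∀ X, Ψ Xᴴ = (Ψ X)ᴴ) (hD : ∀ X, D Xᴴ = (D X)ᴴ) {S : Mat d₂} (hS : IsUnit S)
    (h : ∀ X, D X * S = S * Ψ X) : UnitarilyEquivalent Ψ D := by
  have h' : ∀ X, Sᴴ * D X = Ψ X * Sᴴ := by
    intro X
    have := congrArg conjTranspose (h Xᴴ)
    rwa [conjTranspose_mul, conjTranspose_mul, hΨ, hD, conjTranspose_conjTranspose,
      conjTranspose_conjTranspose] at this
  have hpos : (0 : Mat d₂) ≤ S * Sᴴ := (posSemidef_self_mul_conjTranspose S).nonneg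
  have hunit : IsUnit (S * Sᴴ) := hS.mul (by simpa [star_eq_conjTranspose] using hS.star)
  set R := CFC.sqrt (S * Sᴴ) with hR
  have hRR : R * R = S * Sᴴ := CFC.sqrt_mul_sqrt_self _ hpos
  have hRh : Rᴴ = R := (CFC.sqrt_nonneg (S * Sᴴ)).posSemidef.1
  have hRu : IsUnit R := by
    rw [← hRR] at hunit
    exact isUnit_of_mul_isUnit_left hunit
  have hcomm : ∀ X, R * D X = D X * R := by
    intro X
    have hc : Commute (S * Sᴴ) (D X) := by
      change S * Sᴴ * D X = D X * (S * Sᴴ)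
      rw [Matrix.mul_assoc, h', ← Matrix.mul_assoc, ← h, Matrix.mul_assoc]
    exact hc.cfcₙ_nnreal _
  have hdet := (isUnit_iff_isUnit_det R).1 hRu
  have hRi : (R⁻¹)ᴴ = R⁻¹ := by rw [conjTranspose_nonsing_inv, hRh]
  refine ⟨R⁻¹ * S, ?_, ?_⟩
  · rw [mem_unitaryGroup_iff, star_eq_conjTranspose, conjTranspose_mul, hRi]
    calc R⁻¹ * S * (Sᴴ * R⁻¹) = R⁻¹ * (S * Sᴴ) * R⁻¹ := by simp only [Matrix.mul_assoc]
      _ = 1 := by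
        rw [← hRR, nonsing_inv_mul_cancel_left _ _ hdet, mul_nonsing_inv _ hdet]
  · ext1 X
    have hSd := (isUnit_iff_isUnit_det S).1 hS
    have hc : R⁻¹ * D X = D X * R⁻¹ := by
      rw [← nonsing_inv_mul_cancel_left R (D X * R⁻¹) hdet, ← Matrix.mul_assoc R, hcomm,
        Matrix.mul_assoc (D X), mul_nonsing_inv _ hdet, Matrix.mul_one]
    rw [LinearMap.comp_apply, Ad_apply, conjTranspose_mul, hRi]
    have h2 : Sᴴ * (R⁻¹ * R⁻¹) * S = 1 := by
      rw [← Matrix.mul_inv_rev, hRR, Matrix.mul_inv_rev, Matrix.mul_assoc, Matrix.mul_assoc,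
        nonsing_inv_mul _ hSd, Matrix.mul_one, mul_nonsing_inv]
      rw [det_conjTranspose]
      exact hSd.star
    calc Ψ X = Sᴴ * (R⁻¹ * R⁻¹) * S * Ψ X := by rw [h2, Matrix.one_mul]
      _ = Sᴴ * (R⁻¹ * R⁻¹) * (D X * S) := by rw [h, Matrix.mul_assoc]
      _ = Sᴴ * R⁻¹ * (R⁻¹ * D X) * S := by simp only [Matrix.mul_assoc]
      _ = Sᴴ * R⁻¹ * D X * (R⁻¹ * S) := by rw [hc]; simp only [Matrix.mul_assoc]

end

/-! ### Direct sums of vector states -/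

theorem directSum_vecState_eq_sum {d m : ℕ} (u : Fin m → Fin d → ℂ) :
    directSum (fun i => vecState (u i)) =
      ∑ i, Ad (vecMulVec (u i) (star (Pi.single i 1))) := by
  ext1 X
  ext a b
  simp only [directSum, LinearMap.coe_mk, AddHom.coe_mk, LinearMap.sum_apply, Ad_vecMulVec,
    Matrix.sum_apply, Matrix.smul_apply, vecMulVec_apply, Pi.star_apply, Pi.single_apply,
    diagonal_apply, smul_eq_mul]
  by_cases h : a = b <;> simp [h]

theorem sum_Ad_conjTranspose {ι : Type*} [Fintype ι] {d₁ d₂ : ℕ}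
    (V : ι → Matrix (Fin d₁) (Fin d₂) ℂ) (X : Mat d₁) :
    (∑ i, Ad (V i)) Xᴴ = ((∑ i, Ad (V i)) X)ᴴ := by
  simp [Ad_conjTranspose, conjTranspose_sum]

theorem directSum_vecState_conjTranspose {d m : ℕ} (u : Fin m → Fin d → ℂ) (X : Mat d) :
    directSum (fun i => vecState (u i)) Xᴴ = (directSum (fun i => vecState (u i)) X)ᴴ := by
  rw [directSum_vecState_eq_sum, sum_Ad_conjTranspose]

theorem sum_vecMulVec_eq_one {ι : Type*} [Fintype ι] {d₁ d₂ : ℕ} {x : ι → Fin d₁ → ℂ}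
    {y : ι → Fin d₂ → ℂ} (hx : ∀ k, star (x k) ⬝ᵥ x k = 1)
    (h : (∑ k, Ad (vecMulVec (x k) (star (y k)))) 1 = 1) :
    ∑ k, vecMulVec (y k) (star (y k)) = 1 := by
  simpa [Ad_vecMulVec, vecState_one, hx] using h

/-- If `(S y_k)_l ≠ 0` forces `x_k` to be proportional to `u_l`, the direct sum of the states
`u_l` and the map `∑ ⟨x_k, · x_k⟩ |y_k⟩⟨y_k|` are intertwined by `S`; the hypothesis on spans
encodes this implication. -/
theorem directSum_vecState_intertwining {ι : Type*} [Fintype ι] {d₁ d₂ : ℕ} {x : ι → Fin d₁ → ℂ}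
    {y : ι → Fin d₂ → ℂ} {u : Fin d₂ → Fin d₁ → ℂ} {S : Mat d₂}
    (hx : ∀ k, star (x k) ⬝ᵥ x k = 1) (hu : ∀ l, star (u l) ⬝ᵥ u l = 1)
    (hy : ∑ k, vecMulVec (y k) (star (y k)) = 1)
    (h : ∀ k, vecMulVec (x k) (star (S *ᵥ y k)) ∈ Submodule.span ℂ
      (Set.range fun l => vecMulVec (u l) (star (Pi.single l (1 : ℂ))))) (X : Mat d₁) :
    directSum (fun l => vecState (u l)) X * S =
      S * (∑ k, Ad (vecMulVec (x k) (star (y k)))) X := by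
  have hcol : ∀ l, ∀ Z ∈ Submodule.span ℂ
      (Set.range fun l => vecMulVec (u l) (star (Pi.single l (1 : ℂ)))),
      ∃ c : ℂ, (fun a => Z a l) = c • u l := by
    intro l Z hZ
    induction hZ using Submodule.span_induction with
    | mem Z hZ =>
      obtain ⟨m, rfl⟩ := hZ
      refine ⟨if l = m then 1 else 0, ?_⟩
      ext a
      by_cases hlm : l = m <;> simp [vecMulVec_apply, hlm]
    | zero => exact ⟨0, by ext; simp⟩
    | add A B _ _ hA hB =>
      obtain ⟨a, ha⟩ := hA
      obtain ⟨b, hb⟩ := hB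
      refine ⟨a + b, ?_⟩
      rw [add_smul, ← ha, ← hb]
      rfl
    | smul c A _ hA =>
      obtain ⟨a, ha⟩ := hA
      refine ⟨c * a, ?_⟩
      rw [mul_smul, ← ha]
      rfl
  have hkey : ∀ k l, vecState (u l) X * (S *ᵥ y k) l = vecState (x k) X * (S *ᵥ y k) l := by
    intro k l
    obtain ⟨c, hc⟩ := hcol l _ (h k)
    by_cases h0 : (S *ᵥ y k) l = 0
    · rw [h0, mul_zero, mul_zero]
    set s := star ((S *ᵥ y k) l) with hs
    have hs0 : s ≠ 0 := star_ne_zero.2 h0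
    have hxk : x k = (s⁻¹ * c) • u l := by
      rw [mul_smul, ← hc]
      ext a
      simp only [vecMulVec_apply, Pi.star_apply, Pi.smul_apply, smul_eq_mul, ← hs]
      field_simp
    have hn := hx k
    rw [← vecState_one, hxk, vecState_smul, LinearMap.smul_apply, vecState_one, hu, smul_eq_mul,
      mul_one] at hn
    rw [hxk, vecState_smul, hn, one_smul]
  have hvec : ∀ k, directSum (fun l => vecState (u l)) X *ᵥ (S *ᵥ y k) =
      vecState (x k) X • (S *ᵥ y k) := by
    intro k
    ext l
    simpa [directSum, mulVec_diagonal] using hkey k l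
  calc directSum (fun l => vecState (u l)) X * S
      = directSum (fun l => vecState (u l)) X * S * ∑ k, vecMulVec (y k) (star (y k)) := by
        rw [hy, Matrix.mul_one]
    _ = S * (∑ k, Ad (vecMulVec (x k) (star (y k)))) X := by
        rw [Finset.mul_sum, LinearMap.sum_apply, Finset.mul_sum]
        refine Finset.sum_congr rfl fun k _ => ?_
        rw [Ad_vecMulVec, Matrix.mul_smul, Matrix.mul_assoc, mul_vecMulVec, mul_vecMulVec, hvec,
          smul_vecMulVec]

/-! ### Resolutions of the identity into rank-one operators -/

theorem sum_vecMulVec_mulVec {ι : Type*} [Fintype ι] {d : ℕ} (y : ι → Fin d → ℂ)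
    (v : Fin d → ℂ) :
    (∑ k, vecMulVec (y k) (star (y k))) *ᵥ v = ∑ k, (star (y k) ⬝ᵥ v) • y k := by
  rw [Matrix.sum_mulVec]
  simp [vecMulVec_mulVec]

/-- A resolution of the identity contains a basis, given as the columns of an invertible
matrix. -/
theorem exists_injective_isUnit {ι : Type*} [Fintype ι] {d : ℕ} {y : ι → Fin d → ℂ}
    (hy : ∑ k, vecMulVec (y k) (star (y k)) = 1) :
    ∃ e : Fin d → ι, Function.Injective e ∧ LinearIndependent ℂ (fun j => y (e j)) ∧
      IsUnit (of fun a j => y (e j) a) := by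
  have hspan : Submodule.span ℂ (Set.range y) = ⊤ := by
    rw [eq_top_iff]
    intro v _
    rw [← one_mulVec v, ← hy, sum_vecMulVec_mulVec]
    exact Submodule.sum_mem _ fun k _ => Submodule.smul_mem _ _ (Submodule.subset_span ⟨k, rfl⟩)
  have hrank : Module.finrank ℂ (Submodule.span ℂ (Set.range y)) = d := by
    rw [hspan, finrank_top, Module.finrank_fin_fun]
  obtain ⟨f, hf, -, hli⟩ := Submodule.exists_fun_fin_finrank_span_eq ℂ (Set.range y)
  choose e he using hf
  have hli' : LinearIndependent ℂ (fun j : Fin d => y (e (Fin.cast hrank.symm j))) := by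
    simp only [he]
    exact hli.comp _ (Fin.cast_injective _)
  refine ⟨fun j => e (Fin.cast hrank.symm j), fun i j hij => ?_, hli', ?_⟩
  · exact hli'.injective (congrArg y hij)
  · exact linearIndependent_cols_iff_isUnit.1 hli'

/-- For `d` vectors in `ℂ^d` a resolution of the identity is an orthonormal basis. -/
theorem sum_vecMulVec_eq_one_iff {d : ℕ} (y : Fin d → Fin d → ℂ) :
    ∑ k, vecMulVec (y k) (star (y k)) = 1 ↔
      ∀ i j, star (y i) ⬝ᵥ y j = if i = j then 1 else 0 := by
  let Y : Mat d := of fun a k => y k a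
  have h1 : ∑ k, vecMulVec (y k) (star (y k)) = Y * Yᴴ := by
    ext a b
    simp [Matrix.sum_apply, Matrix.mul_apply, vecMulVec_apply, Y]
  have h2 : ∀ i j, (Yᴴ * Y) i j = star (y i) ⬝ᵥ y j := fun i j => by
    simp [Matrix.mul_apply, dotProduct, Y]
  rw [h1, mul_eq_one_comm, ← Matrix.ext_iff]
  simp only [h2, one_apply]

theorem linearIndependent_vecMulVec {ι : Type*} [Fintype ι] {d₁ d₂ : ℕ} {x : ι → Fin d₁ → ℂ}
    {y : ι → Fin d₂ → ℂ} (hx : ∀ k, star (x k) ⬝ᵥ x k = 1) (hy : LinearIndependent ℂ y) :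
    LinearIndependent ℂ fun k => vecMulVec (x k) (star (y k)) := by
  rw [Fintype.linearIndependent_iff] at hy ⊢
  intro g hg k
  have hx0 : x k ≠ 0 := by
    intro h0
    simpa [h0] using hx k
  obtain ⟨a, ha⟩ := Function.ne_iff.1 hx0
  have h := hy (fun l => star (g l * x l a)) (by
    ext c
    have := congrArg star (congrFun (congrFun hg a) c)
    simpa [Matrix.sum_apply, vecMulVec_apply, mul_assoc, mul_comm, mul_left_comm] using this) k
  exact (mul_eq_zero.1 (star_eq_zero.1 h)).resolve_right ha

theorem exists_unit_vecMulVec_of_rank_eq_one {d₁ d₂ : ℕ} {V : Matrix (Fin d₁) (Fin d₂) ℂ}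
    (hV : V.rank = 1) : ∃ (x : Fin d₁ → ℂ) (y : Fin d₂ → ℂ), star x ⬝ᵥ x = 1 ∧
      V = vecMulVec x (star y) := by
  have hd : 0 < d₁ := by
    have := V.rank_le_card_height
    rw [hV, Fintype.card_fin] at this
    exact this
  obtain ⟨v, -, hv⟩ := finrank_eq_one_iff'.1 hV
  choose c hc using fun j => hv ⟨V *ᵥ Pi.single j 1, ⟨Pi.single j 1, rfl⟩⟩
  have hVx : V = vecMulVec (v : Fin d₁ → ℂ) (star (star c)) := by
    ext a j
    have := congrFun (congrArg Subtype.val (hc j)) a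
    simpa [vecMulVec_apply, mul_comm] using this.symm
  rw [hVx]
  exact exists_unit_vecMulVec hd _ _

theorem rank_vecMulVec_star_eq_one {d₁ d₂ : ℕ} {x : Fin d₁ → ℂ} {y : Fin d₂ → ℂ}
    (hx : star x ⬝ᵥ x = 1) (hy : star y ⬝ᵥ y = 1) : (vecMulVec x (star y)).rank = 1 := by
  refine le_antisymm (rank_vecMulVec_le _ _) (Nat.one_le_iff_ne_zero.2 fun h => ?_)
  rw [Matrix.rank, Submodule.finrank_eq_zero, LinearMap.range_eq_bot] at h
  have h1 : vecMulVec x (star y) *ᵥ y = 0 := by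
    rw [← mulVecLin_apply, h, LinearMap.zero_apply]
  rw [vecMulVec_mulVec, hy] at h1
  have hx0 : x = 0 := by simpa using h1
  simp [hx0] at hx

/-! ### Pure maps and pure states -/

/-- If `Ψ` and `Ad V - Ψ` are completely positive, joining their Kraus decompositions gives one of
`Ad V`, so all Kraus operators of `Ψ` are multiples of `V`. -/
theorem isPure_Ad {d₁ d₂ : ℕ} (V : Matrix (Fin d₁) (Fin d₂) ℂ) : IsPure (Ad V) := by
  refine ⟨isCP_Ad V, fun Ψ hΨ hsub => ?_⟩
  obtain ⟨m, W, hW⟩ := hΨ.exists_kraus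
  obtain ⟨m', W', hW'⟩ := hsub.exists_kraus
  have hsum : ∑ t, Ad (Sum.elim W W' t) = ∑ _t : Fin 1, Ad V := by
    rw [Fintype.sum_sum_type]
    simp [← hW, ← hW']
  have hmem : ∀ t, ∃ c : ℂ, c • V = W t := by
    intro t
    have := mem_span_of_sum_Ad_eq hsum (Sum.inl t)
    rwa [Set.range_const, Submodule.mem_span_singleton] at this
  choose c hc using hmem
  refine ⟨∑ t, Complex.normSq (c t), Finset.sum_nonneg fun t _ => Complex.normSq_nonneg _, ?_⟩
  rw [hW, Complex.ofReal_sum, Finset.sum_smul]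
  refine Finset.sum_congr rfl fun t _ => ?_
  rw [← hc t, Ad_smul, Complex.normSq_eq_conj_mul_self, RCLike.star_def]

theorem IsPure.exists_eq_Ad {d₁ d₂ : ℕ} {Φ : Mat d₁ →ₗ[ℂ] Mat d₂} (h : IsPure Φ) :
    ∃ V, Φ = Ad V := by
  obtain ⟨m, V, hV⟩ := h.1.exists_kraus
  by_cases h0 : ∀ t, Ad (V t) = 0
  · refine ⟨0, ?_⟩
    rw [hV, Finset.sum_eq_zero fun t _ => h0 t]
    ext1 X
    simp [Ad_apply]
  · push Not at h0
    obtain ⟨t, ht⟩ := h0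
    obtain ⟨c, hc, hct⟩ := h.2 (Ad (V t)) (isCP_Ad _) (by
      rw [hV, ← Finset.add_sum_erase _ _ (Finset.mem_univ t), add_sub_cancel_left]
      exact isCP_sum_Ad _ _)
    have hc0 : c ≠ 0 := by
      rintro rfl
      simp [hct] at ht
    refine ⟨((Real.sqrt c⁻¹ : ℝ) : ℂ) • V t, ?_⟩
    have hs : ((Real.sqrt c⁻¹ : ℝ) : ℂ) * (Real.sqrt c⁻¹ : ℝ) = (c : ℂ)⁻¹ := by
      exact_mod_cast Real.mul_self_sqrt (inv_nonneg.2 hc)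
    rw [Ad_smul, RCLike.star_def, Complex.conj_ofReal, hs, hct, smul_smul,
      inv_mul_cancel₀ (by exact_mod_cast hc0), one_smul]

/-- The pure states of `M_d` are the vector states of unit vectors. -/
theorem isPureState_iff {d : ℕ} {φ : Mat d →ₗ[ℂ] ℂ} :
    IsPureState φ ↔ ∃ u : Fin d → ℂ, star u ⬝ᵥ u = 1 ∧ φ = vecState u := by
  constructor
  · rintro ⟨h1, hp⟩
    obtain ⟨V, hV⟩ := hp.exists_eq_Ad
    have hφ : φ = vecState fun a => V a 0 := by
      refine LinearMap.ext fun X => ?_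
      have h := congrFun (congrFun (congrArg (fun Θ => Θ X) hV) 0) 0
      simp only [directSum, LinearMap.coe_mk, AddHom.coe_mk, diagonal_apply_eq] at h
      rw [h, Ad_apply, Matrix.mul_assoc]
      simp [vecState_apply, dotProduct, mulVec, Matrix.mul_apply]
    exact ⟨_, by rw [← vecState_one, ← hφ, h1], hφ⟩
  · rintro ⟨u, hu, rfl⟩
    refine ⟨by rw [vecState_one, hu], ?_⟩
    rw [directSum_vecState_eq_sum]
    simpa using isPure_Ad _

/-! ### Maps that are unitarily equivalent to a direct sum of vector states -/

/-- `Φ` is unitarily equivalent to a direct sum of `d₂` vector states of unit vectors. -/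
def IsVecStateSum {d₁ d₂ : ℕ} (Φ : Mat d₁ →ₗ[ℂ] Mat d₂) : Prop :=
  ∃ u : Fin d₂ → Fin d₁ → ℂ, (∀ l, star (u l) ⬝ᵥ u l = 1) ∧
    UnitarilyEquivalent Φ (directSum fun l => vecState (u l))

theorem Ad_comp_directSum_vecState {d₁ d₂ m : ℕ} (u : Fin m → Fin d₁ → ℂ)
    (T : Matrix (Fin m) (Fin d₂) ℂ) : Ad T ∘ₗ directSum (fun l => vecState (u l)) =
      ∑ l, Ad (vecMulVec (u l) (T l)) := by
  rw [directSum_vecState_eq_sum, Ad_comp_sum]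
  refine Finset.sum_congr rfl fun l _ => ?_
  rw [Ad_comp_Ad, vecMulVec_mul]
  congr 2
  ext j
  simp [vecMul, dotProduct, Pi.single_apply]

theorem directSum_vecState_one {d₁ m : ℕ} {u : Fin m → Fin d₁ → ℂ}
    (hu : ∀ l, star (u l) ⬝ᵥ u l = 1) : directSum (fun l => vecState (u l)) 1 = 1 := by
  simp [directSum, vecState_one, hu]

theorem directSum_vecState_mem_UEB {d₁ m : ℕ} {u : Fin m → Fin d₁ → ℂ}
    (hu : ∀ l, star (u l) ⬝ᵥ u l = 1) : directSum (fun l => vecState (u l)) ∈ UEB d₁ m := by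
  refine ⟨?_, directSum_vecState_one hu⟩
  rw [directSum_vecState_eq_sum]
  exact isEB_sum_Ad_vecMulVec _ _

/-- A direct sum of vector states up to unitary equivalence is the same as a decomposition
along an orthonormal basis `y` of `ℂ^d₂`, here expressed as a resolution of the identity. -/
theorem isVecStateSum_iff {d₁ d₂ : ℕ} {Φ : Mat d₁ →ₗ[ℂ] Mat d₂} :
    IsVecStateSum Φ ↔ ∃ (x : Fin d₂ → Fin d₁ → ℂ) (y : Fin d₂ → Fin d₂ → ℂ),
      (∀ l, star (x l) ⬝ᵥ x l = 1) ∧ ∑ l, vecMulVec (y l) (star (y l)) = 1 ∧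
        Φ = ∑ l, Ad (vecMulVec (x l) (star (y l))) := by
  constructor
  · rintro ⟨u, hu, U, hU, rfl⟩
    have hsum : Ad U ∘ₗ directSum (fun l => vecState (u l)) =
        ∑ l, Ad (vecMulVec (u l) (star (star (U l)))) := by
      simpa using Ad_comp_directSum_vecState u U
    refine ⟨u, fun l => star (U l), hu, sum_vecMulVec_eq_one hu ?_, hsum⟩
    rw [← hsum, LinearMap.comp_apply, directSum_vecState_one hu, Ad_apply, Matrix.mul_one]
    exact mem_unitaryGroup_iff'.1 hU
  · rintro ⟨x, y, hx, hy, rfl⟩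
    refine ⟨x, hx, of fun l => star (y l), ?_, ?_⟩
    · rw [mem_unitaryGroup_iff', ← hy]
      ext a b
      simp [Matrix.sum_apply, Matrix.mul_apply, vecMulVec_apply]
    · rw [Ad_comp_directSum_vecState]
      rfl

theorem IsVecStateSum.of_sum_rank_eq_one {d₁ d₂ : ℕ} {Φ : Mat d₁ →ₗ[ℂ] Mat d₂} (h1 : Φ 1 = 1)
    {V : Fin d₂ → Matrix (Fin d₁) (Fin d₂) ℂ} (hV : ∀ i, (V i).rank = 1)
    (h : Φ = ∑ i, Ad (V i)) : IsVecStateSum Φ := by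
  choose x y hx hxy using fun i => exists_unit_vecMulVec_of_rank_eq_one (hV i)
  simp only [hxy] at h
  exact isVecStateSum_iff.2 ⟨x, y, hx, sum_vecMulVec_eq_one hx (h ▸ h1), h⟩

/-! ### Extreme points -/

theorem sum_eq_sum_comp_add_sum_compl {ι κ M : Type*} [Fintype ι] [Fintype κ] [AddCommMonoid M]
    {e : κ → ι} (he : Function.Injective e) [DecidablePred (· ∈ Set.range e)] (f : ι → M) :
    ∑ i, f i = ∑ j, f (e j) + ∑ i, if i ∈ Set.range e then 0 else f i := by
  classical
  have h : ∑ j, f (e j) = ∑ i, if i ∈ Set.range e then f i else 0 := by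
    rw [← Finset.sum_image (f := f) (s := Finset.univ) (g := e) he.injOn, ← Finset.sum_filter]
    congr 1
    ext i
    simp
  rw [h, ← Finset.sum_add_distrib]
  refine Finset.sum_congr rfl fun i _ => ?_
  split_ifs <;> simp

section
open scoped MatrixOrder

/-- A `C*`-extreme point is a direct sum of vector states. From any Kraus decomposition
`∑ ⟨x_k, · x_k⟩ |y_k⟩⟨y_k|` choose indices `e j` for which the `y_(e j)` form a basis, and split
off half of the corresponding terms. That part is `Ad T₁` applied to a direct sum of vector
states, where `T₁` is invertible because the `y_(e j)` form a basis; the remaining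
part has an invertible value at `1`, because it dominates `Φ / 2`. -/
theorem IsCStarExtreme.isVecStateSum {d₁ d₂ : ℕ} {Φ : Mat d₁ →ₗ[ℂ] Mat d₂}
    (h : IsCStarExtreme Φ) : IsVecStateSum Φ := by
  classical
  obtain ⟨m, x, y, hx, hΦ⟩ := h.1.1.exists_kraus
  have h1 : Φ 1 = 1 := h.1.2
  have hy := sum_vecMulVec_eq_one hx (hΦ ▸ h1)
  obtain ⟨e, he, -, hE⟩ := exists_injective_isUnit hy
  refine ⟨fun j => x (e j), fun j => hx _, UnitarilyEquivalent.symm ?_⟩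
  let r : ℂ := ((Real.sqrt 2⁻¹ : ℝ) : ℂ)
  have hr : star r * r = 2⁻¹ := by
    change starRingEnd ℂ ((Real.sqrt 2⁻¹ : ℝ) : ℂ) * ((Real.sqrt 2⁻¹ : ℝ) : ℂ) = 2⁻¹
    rw [Complex.conj_ofReal, ← Complex.ofReal_mul, Real.mul_self_sqrt (by norm_num),
      Complex.ofReal_inv, Complex.ofReal_ofNat]
  have hr0 : r ≠ 0 := by
    intro h0
    norm_num [h0] at hr
  -- `Θ` keeps half of the terms indexed by the range of `e` and all the other terms.
  let c : Fin m → ℂ := fun i => if i ∈ Set.range e then r else 1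
  have hc : ∀ i, star (c i) * c i = if i ∈ Set.range e then 2⁻¹ else 1 := by
    intro i
    simp only [c]
    split_ifs
    · exact hr
    · simp
  have hsplit : ∀ {M : Type} [AddCommGroup M] [Module ℂ M] (f : Fin m → M),
      ∑ i, f i = (2⁻¹ : ℂ) • ∑ j, f (e j) + ∑ i, (star (c i) * c i) • f i := by
    intro M _ _ f
    have h2 : ∀ i, (star (c i) * c i) • f i =
        (2⁻¹ : ℂ) • f i + (2⁻¹ : ℂ) • if i ∈ Set.range e then 0 else f i := by
      intro i
      rw [hc]
      split_ifs
      · simp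
      · rw [← add_smul]
        norm_num
    simp only [h2, Finset.sum_add_distrib, ← Finset.smul_sum]
    rw [add_left_comm, ← smul_add, ← sum_eq_sum_comp_add_sum_compl he, ← add_smul]
    norm_num
  let T₁ : Mat d₂ := of fun j => r • star (y (e j))
  have hT₁ : IsUnit T₁ := by
    have : T₁ = r • (of fun a j => y (e j) a)ᴴ := rfl
    rw [this, isUnit_iff_isUnit_det, det_smul, det_conjTranspose]
    exact ((isUnit_iff_ne_zero.2 hr0).pow _).mul ((isUnit_iff_isUnit_det _).1 hE).star
  have hAd₁ : Ad T₁ ∘ₗ directSum (fun j => vecState (x (e j))) =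
      (2⁻¹ : ℂ) • ∑ j, Ad (vecMulVec (x (e j)) (star (y (e j)))) := by
    rw [Ad_comp_directSum_vecState, Finset.smul_sum]
    refine Finset.sum_congr rfl fun j _ => ?_
    rw [← hr, ← Ad_smul, ← vecMulVec_smul]
    rfl
  let Θ : Mat d₁ →ₗ[ℂ] Mat d₂ := ∑ i, (star (c i) * c i) • Ad (vecMulVec (x i) (star (y i)))
  have hΦΘ : Φ = Ad T₁ ∘ₗ directSum (fun j => vecState (x (e j))) + Θ := by
    rw [hAd₁, hΦ]
    exact hsplit _
  have hΘ1 : Θ 1 = ∑ i, (star (c i) * c i) • vecMulVec (y i) (star (y i)) := by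
    simp [Θ, Ad_vecMulVec, vecState_one, hx]
  have hpos : (Θ 1).PosDef := by
    have hΘ2 : Θ 1 = (2⁻¹ : ℂ) • 1 +
        ∑ i, if i ∈ Set.range e then (0 : Mat d₂)
          else (2⁻¹ : ℂ) • vecMulVec (y i) (star (y i)) := by
      rw [hΘ1, ← hy, Finset.smul_sum, ← Finset.sum_add_distrib]
      refine Finset.sum_congr rfl fun i _ => ?_
      rw [hc]
      split_ifs
      · rw [add_zero]
      · rw [← add_smul]
        norm_num
    rw [hΘ2]
    have hhalf : (0 : ℂ) < 2⁻¹ := by norm_num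
    refine (PosDef.one.smul hhalf).add_posSemidef (posSemidef_sum _ fun i _ => ?_)
    split_ifs
    · exact PosSemidef.zero
    · exact (posSemidef_vecMulVec_self_star _).smul hhalf.le
  obtain ⟨T₂, hT⟩ := CStarAlgebra.nonneg_iff_eq_star_mul_self.1 hpos.posSemidef.nonneg
  have hT₂ : IsUnit T₂ := by
    have := hpos.isUnit
    rw [hT] at this
    exact isUnit_of_mul_isUnit_right this
  have hdet := (isUnit_iff_isUnit_det T₂).1 hT₂
  have hΨ₂ : Ad T₂⁻¹ ∘ₗ Θ ∈ UEB d₁ d₂ := by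
    constructor
    · have : Ad T₂⁻¹ ∘ₗ Θ = ∑ i, Ad (vecMulVec (x i) (star ((star (c i) • (T₂⁻¹)ᴴ *ᵥ y i)))) := by
        simp only [Θ, Ad_comp_sum, ← Ad_smul, Ad_comp_Ad]
        refine Finset.sum_congr rfl fun i _ => ?_
        rw [star_smul, star_mulVec, conjTranspose_conjTranspose, star_star, Matrix.smul_mul,
          vecMulVec_mul, vecMulVec_smul]
      rw [this]
      exact isEB_sum_Ad_vecMulVec _ _
    · rw [LinearMap.comp_apply, Ad_apply, hT, star_eq_conjTranspose, ← Matrix.mul_assoc,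
        ← conjTranspose_mul, mul_nonsing_inv _ hdet, conjTranspose_one, Matrix.one_mul,
        mul_nonsing_inv _ hdet]
  have hAd₂ : Ad T₂ ∘ₗ (Ad T₂⁻¹ ∘ₗ Θ) = Θ := by
    rw [← LinearMap.comp_assoc, Ad_comp_Ad, nonsing_inv_mul _ hdet]
    ext1 X
    simp [Ad_apply]
  have hD := directSum_vecState_mem_UEB (u := fun j => x (e j)) fun j => hx _
  refine h.2 2 ![T₁, T₂] ![directSum fun j => vecState (x (e j)), Ad T₂⁻¹ ∘ₗ Θ] ?_ ?_ ?_ ?_ 0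
  · exact Fin.forall_fin_two.2 ⟨hT₁, hT₂⟩
  · have := congrArg (fun Ξ => Ξ 1) hΦΘ
    simp only [LinearMap.add_apply, LinearMap.comp_apply, hD.2, Ad_apply, Matrix.mul_one, h1,
      hT, star_eq_conjTranspose] at this
    rw [Fin.sum_univ_two]
    exact this.symm
  · exact Fin.forall_fin_two.2 ⟨hD, hΨ₂⟩
  · rw [Fin.sum_univ_two]
    change Φ = Ad T₁ ∘ₗ _ + Ad T₂ ∘ₗ (Ad T₂⁻¹ ∘ₗ Θ)
    rw [hAd₂]
    exact hΦΘ

end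

/-- Conversely, direct sums of vector states are `C*`-extreme: in a decomposition
`∑ Ad (T i) ∘ Ψ i` every `Ψ i` is intertwined with the direct sum by the adjoint of `T i`. -/
theorem IsVecStateSum.isCStarExtreme {d₁ d₂ : ℕ} {Φ : Mat d₁ →ₗ[ℂ] Mat d₂}
    (h : IsVecStateSum Φ) (hΦ : Φ ∈ UEB d₁ d₂) : IsCStarExtreme Φ := by
  obtain ⟨u, hu, hequiv⟩ := h
  refine ⟨hΦ, fun n T Ψ hT _ hΨ hsum i => UnitarilyEquivalent.trans ?_ hequiv.symm⟩
  obtain ⟨U, hU, hD⟩ := hequiv.symm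
  choose m x y hx hxy using fun i => (hΨ i).1.exists_kraus
  have hkraus : ∑ t : (i : Fin n) × Fin (m i),
      Ad (vecMulVec (x t.1 t.2) (star (y t.1 t.2)) * (T t.1 * U)) =
      ∑ l, Ad (vecMulVec (u l) (star (Pi.single l (1 : ℂ)))) := by
    rw [← directSum_vecState_eq_sum, hD, hsum, Ad_comp_sum, Fintype.sum_sigma]
    refine Finset.sum_congr rfl fun i _ => ?_
    rw [hxy i, ← LinearMap.comp_assoc, Ad_comp_Ad, Ad_comp_sum]
    exact Finset.sum_congr rfl fun k _ => (Ad_comp_Ad _ _).symm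
  have hUu : IsUnit U := IsUnit.of_mul_eq_one _ (mem_unitaryGroup_iff.1 hU)
  have hint := directSum_vecState_intertwining (S := (T i * U)ᴴ) (hx i) hu
    (sum_vecMulVec_eq_one (hx i) (hxy i ▸ (hΨ i).2)) fun k => by
      have := mem_span_of_sum_Ad_eq hkraus ⟨i, k⟩
      rwa [vecMulVec_mul, ← conjTranspose_conjTranspose (T i * U), ← star_mulVec] at this
  rw [← hxy i] at hint
  refine unitarilyEquivalent_of_intertwining (fun X => ?_) (directSum_vecState_conjTranspose u)
    (by simpa [star_eq_conjTranspose] using ((hT i).mul hUu).star) hint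
  rw [hxy i, sum_Ad_conjTranspose]

/-! ### Ranks -/

theorem IsVecStateSum.exists_minimal {d₁ d₂ : ℕ} {Φ : Mat d₁ →ₗ[ℂ] Mat d₂}
    (h : IsVecStateSum Φ) : ∃ V : Fin d₂ → Matrix (Fin d₁) (Fin d₂) ℂ,
      (∀ i, (V i).rank = 1) ∧ Φ = ∑ i, Ad (V i) ∧
        ∀ S : Finset (Fin d₂), S.card < d₂ → ¬ IsUnit (∑ i ∈ S, (V i)ᴴ * V i) := by
  obtain ⟨x, y, hx, hy, rfl⟩ := isVecStateSum_iff.1 h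
  have horth := (sum_vecMulVec_eq_one_iff y).1 hy
  refine ⟨_, fun i => rank_vecMulVec_star_eq_one (hx i) (by simpa using horth i i), rfl,
    fun S hS hunit => ?_⟩
  obtain ⟨l, hl⟩ : ∃ l, l ∉ S := by
    by_contra! hall
    rw [Finset.eq_univ_iff_forall.2 hall, Finset.card_univ, Fintype.card_fin] at hS
    exact hS.false
  have h0 : (∑ i ∈ S, (vecMulVec (x i) (star (y i)))ᴴ * vecMulVec (x i) (star (y i))) *ᵥ y l =
      0 := by
    rw [Matrix.sum_mulVec]
    refine Finset.sum_eq_zero fun i hi => ?_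
    rw [← mulVec_mulVec, vecMulVec_mulVec, horth, if_neg (by rintro rfl; exact hl hi)]
    simp
  have hyl : y l = 0 := mulVec_injective_iff_isUnit.2 hunit (by rw [h0, mulVec_zero])
  simpa [hyl] using horth l l

/-- Fewer than `d₂` rank-one terms cannot resolve the identity of `M_d₂`. -/
theorem isVecStateSum_iff_ebRank {d₁ d₂ : ℕ} {Φ : Mat d₁ →ₗ[ℂ] Mat d₂} (h1 : Φ 1 = 1) :
    IsVecStateSum Φ ↔ ebRank Φ = d₂ := by
  constructor
  · intro h
    obtain ⟨V, hV, hΦ, -⟩ := h.exists_minimal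
    refine le_antisymm (Nat.sInf_le ⟨V, hV, hΦ⟩) (le_csInf ⟨_, V, hV, hΦ⟩ ?_)
    rintro n ⟨W, hW, hΦW⟩
    choose x y hx hxy using fun i => exists_unit_vecMulVec_of_rank_eq_one (hW i)
    simp only [hxy] at hΦW
    obtain ⟨e, he, -⟩ := exists_injective_isUnit (sum_vecMulVec_eq_one hx (hΦW ▸ h1))
    simpa using Fintype.card_le_of_injective e he
  · intro h
    -- For `d₂ = 0` the infimum says nothing: it is `0` for the empty set too.
    rcases Nat.eq_zero_or_pos d₂ with rfl | hd
    · exact ⟨Fin.elim0, fun l => l.elim0, 1, one_mem _, linearMap_ext_single fun _ _ c => c.elim0⟩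
    · have hmem := Nat.sInf_mem (Nat.nonempty_of_pos_sInf (by rw [← h] at hd; exact hd))
      change ebRank Φ ∈ _ at hmem
      rw [h] at hmem
      obtain ⟨V, hV, hΦ⟩ := hmem
      exact .of_sum_rank_eq_one h1 hV hΦ

theorem IsVecStateSum.choiRank_eq {d₁ d₂ : ℕ} {Φ : Mat d₁ →ₗ[ℂ] Mat d₂}
    (h : IsVecStateSum Φ) : choiRank Φ = d₂ := by
  obtain ⟨x, y, hx, hy, rfl⟩ := isVecStateSum_iff.1 h
  obtain ⟨e, he, hli, -⟩ := exists_injective_isUnit hy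
  have hliV : LinearIndependent ℂ fun k => vecMulVec (x k) (star (y k)) := by
    refine linearIndependent_vecMulVec hx ?_
    let σ := Equiv.ofBijective e (Finite.injective_iff_bijective.1 he)
    exact (linearIndependent_equiv σ).1 hli
  refine le_antisymm (Nat.sInf_le ⟨_, hliV, rfl⟩) (le_csInf ⟨_, _, hliV, rfl⟩ ?_)
  rintro n ⟨W, -, hW⟩
  have hle : Submodule.span ℂ (Set.range fun k => vecMulVec (x k) (star (y k))) ≤
      Submodule.span ℂ (Set.range W) := by
    rw [Submodule.span_le]
    rintro _ ⟨k, rfl⟩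
    exact mem_span_of_sum_Ad_eq hW k
  have h1 := Submodule.finrank_mono hle
  rw [finrank_span_eq_card hliV, Fintype.card_fin] at h1
  exact h1.trans ((finrank_range_le_card W).trans_eq (Fintype.card_fin n))

/-- If the Choi-rank is `d₂`, then the Kraus operators `|x_(e j)⟩⟨y_(e j)|` for which the
`y_(e j)` form a basis span all Kraus operators, so the inverse of the matrix with columns
`y_(e j)` intertwines `Φ` with a direct sum of vector states. -/
theorem isVecStateSum_of_choiRank_eq {d₁ d₂ : ℕ} {Φ : Mat d₁ →ₗ[ℂ] Mat d₂} (hΦ : Φ ∈ UEB d₁ d₂)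
    (h : choiRank Φ = d₂) : IsVecStateSum Φ := by
  -- For `d₂ = 0` the infimum says nothing: it is `0` for the empty set too.
  rcases Nat.eq_zero_or_pos d₂ with rfl | hd
  · exact ⟨Fin.elim0, fun l => l.elim0, 1, one_mem _, linearMap_ext_single fun _ _ c => c.elim0⟩
  have hmem := Nat.sInf_mem (Nat.nonempty_of_pos_sInf (by rw [← h] at hd; exact hd))
  change choiRank Φ ∈ _ at hmem
  rw [h] at hmem
  obtain ⟨W, hWli, hW⟩ := hmem
  obtain ⟨m, x, y, hx, hxy⟩ := hΦ.1.exists_kraus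
  have hy := sum_vecMulVec_eq_one hx (hxy ▸ hΦ.2)
  obtain ⟨e, he, hli, hE⟩ := exists_injective_isUnit hy
  have hliV := linearIndependent_vecMulVec (x := fun j => x (e j)) (fun j => hx _) hli
  have hmemW := mem_span_of_sum_Ad_eq (hxy.symm.trans hW)
  have hspan : Submodule.span ℂ (Set.range fun j => vecMulVec (x (e j)) (star (y (e j)))) =
      Submodule.span ℂ (Set.range W) := by
    refine Submodule.eq_of_le_of_finrank_eq ?_ ?_
    · rw [Submodule.span_le]
      rintro _ ⟨j, rfl⟩
      exact hmemW (e j)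
    · rw [finrank_span_eq_card hliV, finrank_span_eq_card hWli]
  set E : Mat d₂ := of fun a j => y (e j) a with hEdef
  have hdet := (isUnit_iff_isUnit_det E).1 hE
  have hEy : ∀ j, E⁻¹ *ᵥ y (e j) = Pi.single j 1 := by
    intro j
    have : y (e j) = E *ᵥ Pi.single j 1 := by
      ext a
      simp [hEdef]
    rw [this, mulVec_mulVec, nonsing_inv_mul _ hdet, one_mulVec]
  have hint := directSum_vecState_intertwining (S := E⁻¹) (u := fun j => x (e j)) hx
    (fun j => hx _) hy fun k => by
      have hk := hmemW k
      rw [← hspan] at hk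
      rw [star_mulVec, ← vecMulVec_mul]
      generalize vecMulVec (x k) (star (y k)) = Z at hk ⊢
      induction hk using Submodule.span_induction with
      | mem Z hZ =>
        obtain ⟨j, rfl⟩ := hZ
        refine Submodule.subset_span ⟨j, ?_⟩
        beta_reduce
        rw [vecMulVec_mul, ← star_mulVec, hEy]
      | zero => simp
      | add A B _ _ hA hB =>
        rw [Matrix.add_mul]
        exact add_mem hA hB
      | smul c A _ hA =>
        rw [Matrix.smul_mul]
        exact Submodule.smul_mem _ c hA
  rw [← hxy] at hint
  refine ⟨fun j => x (e j), fun j => hx _, unitarilyEquivalent_of_intertwining (fun X => ?_)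
    (directSum_vecState_conjTranspose _) ?_ hint⟩
  · rw [hxy, sum_Ad_conjTranspose]
  · exact (isUnit_nonsing_inv_iff).2 hE

/-! ### Spectral forms -/

/-- Equal states are collected: the `i`-th projection belongs to the coordinates `l` that carry the
`i`-th distinct state. -/
theorem IsVecStateSum.exists_projections {d₁ d₂ : ℕ} {Φ : Mat d₁ →ₗ[ℂ] Mat d₂}
    (h : IsVecStateSum Φ) : ∃ n ≤ d₂, ∃ (φ : Fin n → (Mat d₁ →ₗ[ℂ] ℂ)) (P : Fin n → Mat d₂),
      (∀ i, IsPureState (φ i)) ∧ Function.Injective φ ∧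
      (∀ i, IsStarProjection (P i)) ∧ (Pairwise fun i j => P i * P j = 0) ∧
      ∑ i, P i = 1 ∧ ∀ X, Φ X = ∑ i, φ i X • P i := by
  classical
  obtain ⟨u, hu, U, hU, rfl⟩ := h
  have hUU := mem_unitaryGroup_iff.1 hU
  have hUU' := mem_unitaryGroup_iff'.1 hU
  rw [star_eq_conjTranspose] at hUU hUU'
  let s := Finset.univ.image fun l => vecState (u l)
  let ε := s.equivFin
  let c : Fin d₂ → Fin s.card := fun l =>
    ε ⟨vecState (u l), Finset.mem_image_of_mem _ (Finset.mem_univ l)⟩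
  have hc : ∀ l, ((ε.symm (c l) : s) : Mat d₁ →ₗ[ℂ] ℂ) = vecState (u l) := fun l => by simp [c]
  let Q : Fin s.card → Mat d₂ := fun i => diagonal fun l => if c l = i then 1 else 0
  have hQ : ∀ i j, (Uᴴ * Q i * U) * (Uᴴ * Q j * U) = Uᴴ * (Q i * Q j) * U := by
    intro i j
    calc (Uᴴ * Q i * U) * (Uᴴ * Q j * U) = Uᴴ * Q i * (U * Uᴴ) * Q j * U := by
          simp only [Matrix.mul_assoc]
      _ = Uᴴ * (Q i * Q j) * U := by simp only [hUU, Matrix.mul_one, Matrix.mul_assoc]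
  refine ⟨s.card, Finset.card_image_le.trans_eq (by simp), fun i => ε.symm i,
    fun i => Uᴴ * Q i * U, fun i => ?_, ?_, fun i => ⟨?_, ?_⟩, fun i j hij => ?_, ?_, fun X => ?_⟩
  · obtain ⟨l, -, hl⟩ := Finset.mem_image.1 (ε.symm i).2
    exact isPureState_iff.2 ⟨u l, hu l, hl.symm⟩
  · exact Subtype.val_injective.comp ε.symm.injective
  · change _ * _ = _
    rw [hQ]
    simp [Q, ← ite_and]
  · change _ᴴ = _
    simp only [conjTranspose_mul, conjTranspose_conjTranspose, Matrix.mul_assoc, Q,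
      diagonal_conjTranspose]
    congr 3
    ext l
    by_cases hl : c l = i <;> simp [hl]
  · have h0 : Q i * Q j = 0 := by
      simp only [Q, diagonal_mul_diagonal]
      rw [← diagonal_zero]
      congr 1
      ext l
      by_cases hl : c l = i
      · simp [hl, hij]
      · simp [hl]
    beta_reduce
    rw [hQ, h0, Matrix.mul_zero, Matrix.zero_mul]
  · have h1 : ∑ i, Q i = 1 := by
      ext a b
      by_cases hab : a = b <;> simp [Q, Matrix.sum_apply, one_apply, hab]
    rw [← Finset.sum_mul, ← Finset.mul_sum, h1, Matrix.mul_one, hUU']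
  · have hX : directSum (fun l => vecState (u l)) X =
        ∑ i, ((ε.symm i : s) : Mat d₁ →ₗ[ℂ] ℂ) X • Q i := by
      ext a b
      by_cases hab : a = b
      · subst hab
        simp [Q, directSum, Matrix.sum_apply, hc]
      · simp [Q, directSum, Matrix.sum_apply, hab]
    rw [LinearMap.comp_apply, hX, map_sum]
    refine Finset.sum_congr rfl fun i _ => ?_
    rw [map_smul, Ad_apply]

/-- Columns of the projections `P i` that form a basis are eigenvectors of every `Φ X`, so the
matrix built from them intertwines `Φ` with a direct sum of the states. -/
theorem isVecStateSum_of_projections {d₁ d₂ n : ℕ} {Φ : Mat d₁ →ₗ[ℂ] Mat d₂}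
    (hΦ : Φ ∈ UEB d₁ d₂) {φ : Fin n → (Mat d₁ →ₗ[ℂ] ℂ)} {P : Fin n → Mat d₂}
    (hφ : ∀ i, IsPureState (φ i)) (hP : ∀ i, IsStarProjection (P i))
    (horth : Pairwise fun i j => P i * P j = 0) (hsum : ∑ i, P i = 1)
    (h : ∀ X, Φ X = ∑ i, φ i X • P i) : IsVecStateSum Φ := by
  choose u hu hφu using fun i => isPureState_iff.1 (hφ i)
  let y : Fin n × Fin d₂ → Fin d₂ → ℂ := fun t => P t.1 *ᵥ Pi.single t.2 1
  have hy : ∑ t, vecMulVec (y t) (star (y t)) = 1 := by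
    rw [← hsum, Fintype.sum_prod_type]
    refine Finset.sum_congr rfl fun i _ => ?_
    have hPP : P i * (P i)ᴴ = P i := by
      rw [← star_eq_conjTranspose, (hP i).isSelfAdjoint.star_eq, (hP i).isIdempotentElem.eq]
    conv_rhs => rw [← hPP]
    ext a b
    simp [Matrix.sum_apply, Matrix.mul_apply, vecMulVec_apply, y]
  obtain ⟨e, -, -, hE⟩ := exists_injective_isUnit hy
  set E : Mat d₂ := of fun a j => y (e j) a with hEdef
  have hdet := (isUnit_iff_isUnit_det E).1 hE
  have heig : ∀ X t, Φ X *ᵥ y t = φ t.1 X • y t := by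
    intro X t
    rw [h, Matrix.sum_mulVec, Finset.sum_eq_single t.1]
    · rw [smul_mulVec, mulVec_mulVec, (hP t.1).isIdempotentElem.eq]
    · intro i _ hi
      rw [smul_mulVec, mulVec_mulVec, horth hi, zero_mulVec, smul_zero]
    · simp
  have hint : ∀ X, Φ X * E = E * directSum (fun j => vecState (u (e j).1)) X := by
    intro X
    ext a j
    have := congrFun (heig X (e j)) a
    simp only [directSum, LinearMap.coe_mk, AddHom.coe_mk, mul_diagonal]
    rw [← hφu, mul_comm]
    exact this
  refine ⟨fun j => u (e j).1, fun j => hu _, UnitarilyEquivalent.symm ?_⟩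
  refine unitarilyEquivalent_of_intertwining (directSum_vecState_conjTranspose _) (fun X => ?_)
    hE hint
  obtain ⟨m, x, z, -, hxz⟩ := hΦ.1.exists_kraus
  rw [hxz, sum_Ad_conjTranspose]

theorem inner_toEuclideanLin {d : ℕ} (u : EuclideanSpace ℂ (Fin d)) (X : Mat d) :
    inner ℂ u (Matrix.toEuclideanLin X u) = vecState u.ofLp X := by
  rw [EuclideanSpace.inner_eq_star_dotProduct, vecState_apply, dotProduct_comm]
  rfl

theorem norm_eq_one_iff_star_dotProduct {d : ℕ} (u : EuclideanSpace ℂ (Fin d)) :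
    ‖u‖ = 1 ↔ star u.ofLp ⬝ᵥ u.ofLp = 1 := by
  rw [dotProduct_comm, ← EuclideanSpace.inner_eq_star_dotProduct, inner_self_eq_norm_sq_to_K]
  rw [← RCLike.ofReal_pow]
  change ‖u‖ = 1 ↔ ((‖u‖ ^ 2 : ℝ) : ℂ) = 1
  rw [Complex.ofReal_eq_one, pow_eq_one_iff_of_nonneg (norm_nonneg u) two_ne_zero]

theorem isVecStateSum_iff_orthonormalBasis {d₁ d₂ : ℕ} {Φ : Mat d₁ →ₗ[ℂ] Mat d₂} :
    IsVecStateSum Φ ↔ ∃ (u : Fin d₂ → EuclideanSpace ℂ (Fin d₁))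
        (v : OrthonormalBasis (Fin d₂) ℂ (EuclideanSpace ℂ (Fin d₂))),
        (∀ i, ‖u i‖ = 1) ∧
        ∀ X, Φ X = ∑ i, inner ℂ (u i) (Matrix.toEuclideanLin X (u i)) • ketBra (v i) (v i) := by
  have hket : ∀ v : EuclideanSpace ℂ (Fin d₂), ketBra v v = vecMulVec v.ofLp (star v.ofLp) :=
    fun _ => rfl
  simp only [isVecStateSum_iff, inner_toEuclideanLin, norm_eq_one_iff_star_dotProduct, hket]
  constructor
  · rintro ⟨x, y, hx, hy, rfl⟩
    have ho : Orthonormal ℂ fun l => WithLp.toLp 2 (y l) := by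
      rw [orthonormal_iff_ite]
      intro i j
      rw [EuclideanSpace.inner_toLp_toLp, dotProduct_comm]
      exact (sum_vecMulVec_eq_one_iff y).1 hy i j
    let v := OrthonormalBasis.mk ho (ge_of_eq
      (ho.linearIndependent.span_eq_top_of_card_eq_finrank' (by simp)))
    refine ⟨fun l => WithLp.toLp 2 (x l), v, hx, fun X => ?_⟩
    rw [LinearMap.sum_apply]
    refine Finset.sum_congr rfl fun l _ => ?_
    rw [Ad_vecMulVec, OrthonormalBasis.coe_mk]
  · rintro ⟨u, v, hu, hΦ⟩
    refine ⟨fun l => (u l).ofLp, fun l => (v l).ofLp, hu, ?_, ?_⟩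
    · rw [sum_vecMulVec_eq_one_iff]
      intro i j
      rw [dotProduct_comm, ← EuclideanSpace.inner_eq_star_dotProduct]
      exact orthonormal_iff_ite.1 v.orthonormal i j
    · refine LinearMap.ext fun X => ?_
      rw [hΦ, LinearMap.sum_apply]
      simp only [Ad_vecMulVec]

theorem isVecStateSum_iff_pureState {d₁ d₂ : ℕ} {Φ : Mat d₁ →ₗ[ℂ] Mat d₂} :
    IsVecStateSum Φ ↔ ∃ φ : Fin d₂ → (Mat d₁ →ₗ[ℂ] ℂ),
      (∀ i, IsPureState (φ i)) ∧ UnitarilyEquivalent Φ (directSum φ) := by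
  constructor
  · rintro ⟨u, hu, h⟩
    exact ⟨_, fun i => isPureState_iff.2 ⟨u i, hu i, rfl⟩, h⟩
  · rintro ⟨φ, hφ, h⟩
    choose u hu hφu using fun i => isPureState_iff.1 (hφ i)
    obtain rfl : φ = fun i => vecState (u i) := funext hφu
    exact ⟨u, hu, h⟩

end EBMaps

theorem theorem5p2 (d₁ d₂ : ℕ) (Φ : Mat d₁ →ₗ[ℂ] Mat d₂) (hΦ : Φ ∈ UEB d₁ d₂) :
    List.TFAE [
      IsCStarExtreme Φ,
      ∃ V : Fin d₂ → Matrix (Fin d₁) (Fin d₂) ℂ,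
        (∀ i, (V i).rank = 1) ∧ Φ = ∑ i, Ad (V i) ∧
        ∀ S : Finset (Fin d₂), S.card < d₂ → ¬ IsUnit (∑ i ∈ S, (V i)ᴴ * V i),
      ebRank Φ = d₂,
      choiRank Φ = d₂,
      ∃ n ≤ d₂, ∃ (φ : Fin n → (Mat d₁ →ₗ[ℂ] ℂ)) (P : Fin n → Mat d₂),
        (∀ i, IsPureState (φ i)) ∧ Function.Injective φ ∧
        (∀ i, IsStarProjection (P i)) ∧ (Pairwise fun i j => P i * P j = 0) ∧
        ∑ i, P i = 1 ∧ ∀ X, Φ X = ∑ i, φ i X • P i,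
      ∃ (u : Fin d₂ → EuclideanSpace ℂ (Fin d₁))
        (v : OrthonormalBasis (Fin d₂) ℂ (EuclideanSpace ℂ (Fin d₂))),
        (∀ i, ‖u i‖ = 1) ∧
        ∀ X, Φ X = ∑ i, inner ℂ (u i) (Matrix.toEuclideanLin X (u i)) • ketBra (v i) (v i),
      ∃ φ : Fin d₂ → (Mat d₁ →ₗ[ℂ] ℂ),
        (∀ i, IsPureState (φ i)) ∧ UnitarilyEquivalent Φ (directSum φ)] := by
  rw [← isVecStateSum_iff_orthonormalBasis, ← isVecStateSum_iff_pureState,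
    ← isVecStateSum_iff_ebRank hΦ.2]
  tfae_have 1 → 3 := IsCStarExtreme.isVecStateSum
  tfae_have 3 → 1 := fun h => h.isCStarExtreme hΦ
  tfae_have 2 → 3 := fun ⟨_, hV, h, _⟩ => .of_sum_rank_eq_one hΦ.2 hV h
  tfae_have 3 → 2 := IsVecStateSum.exists_minimal
  tfae_have 3 → 4 := IsVecStateSum.choiRank_eq
  tfae_have 4 → 3 := isVecStateSum_of_choiRank_eq hΦ
  tfae_have 3 → 5 := IsVecStateSum.exists_projections
  tfae_have 5 → 3 := fun ⟨_, _, _, _, hφ, _, hP, horth, hsum, h⟩ =>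
    isVecStateSum_of_projections hΦ hφ hP horth hsum h
  tfae_have 3 ↔ 6 := Iff.rfl
  tfae_have 3 ↔ 7 := Iff.rfl
  tfae_finish
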